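/- There is an absolute constant $c>0$ such that the following holds. Let $H$ be a complex Hilbert space, $I$ a set, and let $OH(I)$ be the operator Hilbert space, i.e. $\ell_2(I)$ with the operator space structure given by $$\|(a_{pq})\|_{M_m(OH(I))}=\Big\|\big(\langle a_{pq},a_{p'q'}\rangle\big)_{(p,p'),(q,q')}\Big\|_{M_{m^2}}^{1/2}.$$ Let $u:B(H)\to OH(I)$ be a completely bounded linear map, and suppose that there are a real number $K$ and a state $f$ on $B(H)$ such that $$\|u(x)\|^2\le K^2\big(f(xx^*)\,f(x^*x)\big)^{1/2}\qquad\text{for all }x\in B(H).$$ Then for every integer $n>1$ and all $x_1,\dots,x_n\in B(H)$, $$\sum_{i=1}^n\|u(x_i)\|^2\le K^2\,(c\log n+1)\,\Big\|\sum_{i=1}^n x_i\otimes\bar x_i\Big\|_{\min},$$ where $\bar x$ denotes the operator $\bar h\mapsto\overline{xh}$ on the complex conjugate Hilbert space $\overline H$, and $\|\cdot\|_{\min}$ is the operator norm on the Hilbert space tensor product $H\otimes_2\overline H$. -/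

import Mathlib

noncomputable section

open scoped ComplexOrder TensorProduct

/-! ### The complex conjugate of a Hilbert space -/

/-- The complex conjugate `H̄` of a complex Hilbert space `H`: the same additive group, with
scalar multiplication `(z, h) ↦ z̄ h` and inner product `⟪h, k⟫_{H̄} = ⟪k, h⟫_H`. -/
def ConjSpace (H : Type*) : Type _ := H

namespace ConjSpace

variable {H : Type*} [NormedAddCommGroup H] [InnerProductSpace ℂ H]

instance : NormedAddCommGroup (ConjSpace H) := inferInstanceAs (NormedAddCommGroup H)

instance [CompleteSpace H] : CompleteSpace (ConjSpace H) := inferInstanceAs (CompleteSpace H)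

/-- The canonical map `h ↦ h̄` from `H` to `H̄`. -/
def mk (h : H) : ConjSpace H := h

/-- The vector of `H` underlying a vector of `H̄`. -/
def out (h : ConjSpace H) : H := h

instance : Module ℂ (ConjSpace H) := Module.compHom H (starRingEnd ℂ)

theorem smul_def (z : ℂ) (h : ConjSpace H) : z • h = mk ((starRingEnd ℂ) z • out h) := rfl

instance : InnerProductSpace ℂ (ConjSpace H) where
  norm_smul_le z h := by
    have h1 : ‖z • h‖ = ‖(starRingEnd ℂ) z • out h‖ := rfl
    have h2 : ‖h‖ = ‖out h‖ := rfl
    rw [h1, h2, norm_smul, RCLike.norm_conj]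
  inner h k := inner ℂ (out k) (out h)
  norm_sq_eq_re_inner h := norm_sq_eq_re_inner (𝕜 := ℂ) (out h)
  conj_inner_symm h k := inner_conj_symm (out k) (out h)
  add_left h k l := inner_add_right (out l) (out h) (out k)
  smul_left h k z := inner_smul_right (out k) (out h) ((starRingEnd ℂ) z)

theorem inner_def (h k : ConjSpace H) : inner ℂ h k = inner ℂ (out k) (out h) := rfl

/-- The operator `x̄` on `H̄` given by `x̄ h̄ = (x h)‾`, for `x` in `B(H)`. -/
def conjOp (x : H →L[ℂ] H) : ConjSpace H →L[ℂ] ConjSpace H where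
  toFun h := mk (x (out h))
  map_add' h k := x.map_add (out h) (out k)
  map_smul' z h := x.map_smul ((starRingEnd ℂ) z) (out h)
  cont := x.continuous

theorem conjOp_mk (x : H →L[ℂ] H) (h : H) : conjOp x (mk h) = mk (x h) := rfl

end ConjSpace

/-! ### Tensor products of operators and the minimal norm -/

section Tensor

variable {H K : Type*} [NormedAddCommGroup H] [InnerProductSpace ℂ H]
  [NormedAddCommGroup K] [InnerProductSpace ℂ K]

theorem norm_sum_tmul_orthonormal {n : ℕ} {b : Fin n → K} (hb : Orthonormal ℂ b) (v : Fin n → H) :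
    ‖∑ i, v i ⊗ₜ[ℂ] b i‖ ^ 2 = ∑ i, ‖v i‖ ^ 2 := by
  rw [norm_sq_eq_re_inner (𝕜 := ℂ)]
  simp only [sum_inner, inner_sum, TensorProduct.inner_tmul, orthonormal_iff_ite.mp hb]
  simp [norm_sq_eq_re_inner (𝕜 := ℂ), -inner_self_eq_norm_sq_to_K]

theorem exists_orthonormal_tmul (z : H ⊗[ℂ] K) :
    ∃ (n : ℕ) (b : Fin n → K) (v : Fin n → H), Orthonormal ℂ b ∧ z = ∑ i, v i ⊗ₜ[ℂ] b i := by
  obtain ⟨m, x, y, rfl⟩ := TensorProduct.exists_sum_tmul_eq z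
  let F : Submodule ℂ K := Submodule.span ℂ (Set.range y)
  have : FiniteDimensional ℂ F := FiniteDimensional.span_of_finite ℂ (Set.finite_range y)
  let b := stdOrthonormalBasis ℂ F
  have hy : ∀ j, y j = ∑ i, inner ℂ (b i : K) (y j) • (b i : K) := by
    intro j
    have h := congrArg (Subtype.val) (b.sum_repr' ⟨y j, Submodule.subset_span ⟨j, rfl⟩⟩)
    simpa using h.symm
  refine ⟨_, fun i => (b i : K), fun i => ∑ j, inner ℂ (b i : K) (y j) • x j, ?_, ?_⟩
  · exact b.orthonormal.comp_linearIsometry F.subtypeₗᵢ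
  · simp only [TensorProduct.sum_tmul, TensorProduct.smul_tmul]
    rw [Finset.sum_comm]
    refine Finset.sum_congr rfl fun j _ => ?_
    rw [← TensorProduct.tmul_sum, ← hy j]

theorem norm_map_id_le (a : H →L[ℂ] H) (z : H ⊗[ℂ] K) :
    ‖TensorProduct.map (a : H →ₗ[ℂ] H) (LinearMap.id : K →ₗ[ℂ] K) z‖ ≤ ‖a‖ * ‖z‖ := by
  obtain ⟨n, b, v, hb, rfl⟩ := exists_orthonormal_tmul z
  refine (sq_le_sq₀ (norm_nonneg _) (by positivity)).mp ?_
  simp only [map_sum, TensorProduct.map_tmul, LinearMap.id_coe, id_eq]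
  rw [norm_sum_tmul_orthonormal hb, mul_pow, norm_sum_tmul_orthonormal hb, Finset.mul_sum]
  refine Finset.sum_le_sum fun i _ => ?_
  rw [← mul_pow]
  exact pow_le_pow_left₀ (norm_nonneg _) (a.le_opNorm _) 2

theorem norm_map_le (a : H →L[ℂ] H) (b : K →L[ℂ] K) (z : H ⊗[ℂ] K) :
    ‖TensorProduct.map (a : H →ₗ[ℂ] H) (b : K →ₗ[ℂ] K) z‖ ≤ ‖a‖ * ‖b‖ * ‖z‖ := by
  have h1 : TensorProduct.map (a : H →ₗ[ℂ] H) (b : K →ₗ[ℂ] K) z =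
      TensorProduct.map (a : H →ₗ[ℂ] H) LinearMap.id
        (TensorProduct.comm ℂ K H (TensorProduct.map (b : K →ₗ[ℂ] K) LinearMap.id
          (TensorProduct.comm ℂ H K z))) := by
    induction z using TensorProduct.induction_on with
    | zero => simp
    | tmul x y => simp
    | add x y hx hy => simp only [map_add, hx, hy]
  rw [h1, mul_assoc]
  refine (norm_map_id_le a _).trans (mul_le_mul_of_nonneg_left ?_ (norm_nonneg _))
  rw [TensorProduct.norm_comm]
  refine (norm_map_id_le b _).trans ?_
  rw [TensorProduct.norm_comm]

variable (H K) in
/-- The Hilbert space tensor product `H ⊗₂ K`: the completion of the algebraic tensor product for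
the inner product `⟪h ⊗ k, h' ⊗ k'⟫ = ⟪h, h'⟫ ⟪k, k'⟫`. -/
abbrev HilbertTensor : Type _ := UniformSpace.Completion (H ⊗[ℂ] K)

/-- The operator `a ⊗ b` on `H ⊗₂ K`, for `a` in `B(H)` and `b` in `B(K)`: the continuous
extension of `h ⊗ k ↦ a h ⊗ b k`. -/
def tensorOp (a : H →L[ℂ] H) (b : K →L[ℂ] K) : HilbertTensor H K →L[ℂ] HilbertTensor H K :=
  ((TensorProduct.map (a : H →ₗ[ℂ] H) (b : K →ₗ[ℂ] K)).mkContinuous (‖a‖ * ‖b‖)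
    (norm_map_le a b)).completion

theorem tensorOp_tmul (a : H →L[ℂ] H) (b : K →L[ℂ] K) (h : H) (k : K) :
    tensorOp a b ((h ⊗ₜ[ℂ] k : H ⊗[ℂ] K) : HilbertTensor H K) =
      ((a h ⊗ₜ[ℂ] b k : H ⊗[ℂ] K) : HilbertTensor H K) := by
  simp [tensorOp]

/-- The norm `‖∑ᵢ xᵢ ⊗ x̄ᵢ‖_min` of `∑ᵢ xᵢ ⊗ x̄ᵢ` in the minimal tensor product
`B(H) ⊗_min B(H)‾ ⊆ B(H ⊗₂ H̄)`. -/
def minNormConj {n : ℕ} (x : Fin n → (H →L[ℂ] H)) : ℝ :=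
  ‖∑ i, tensorOp (x i) (ConjSpace.conjOp (x i))‖

end Tensor

/-! ### States -/

/-- A state on `B(H)`: a positive linear functional `f` with `f 1 = 1`. -/
def IsState {H : Type*} [NormedAddCommGroup H] [InnerProductSpace ℂ H] [CompleteSpace H]
    (f : (H →L[ℂ] H) →ₗ[ℂ] ℂ) : Prop :=
  (∀ x : H →L[ℂ] H, 0 ≤ f (star x * x)) ∧ f 1 = 1

/-! ### The operator Hilbert space -/

/-- The Hilbert space `ℓ₂(I)` underlying the operator space `OH(I)`, whose operator space
structure is given by the matrix norms `OH.matrixNorm`. -/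
abbrev OH (I : Type*) : Type _ := lp (fun _ : I => ℂ) 2

/-- The norm of `M_m(OH(I))`. If `a = ∑ₖ Tₖ ⊗ eₖ` with `Tₖ` in `M_m` and `(eₖ)` the canonical
basis, then `‖a‖ = ‖∑ₖ Tₖ ⊗ T̄ₖ‖^{1/2}`; the entry of `∑ₖ Tₖ ⊗ T̄ₖ` in row `(p, p')` and
column `(q, q')` is `∑ₖ (Tₖ)_{pq} conj (Tₖ)_{p'q'}`, the inner product of `a_{pq}` and
`a_{p'q'}` (linear in `a_{pq}`). -/
def OH.matrixNorm {I : Type*} {m : ℕ} (a : Matrix (Fin m) (Fin m) (OH I)) : ℝ :=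
  Real.sqrt ‖CStarMatrix.ofMatrix (Matrix.of fun p q : Fin m × Fin m =>
    inner ℂ (a p.2 q.2) (a p.1 q.1))‖

/-- A linear map `u : B(H) → OH(I)` is completely bounded if the maps
`M_m(B(H)) → M_m(OH(I))`, `(a_{pq}) ↦ (u(a_{pq}))`, are bounded uniformly in `m`.
The norm of `M_m(B(H))` is its C⋆-norm. -/
def IsCompletelyBounded {H : Type*} [NormedAddCommGroup H] [InnerProductSpace ℂ H]
    [CompleteSpace H] {I : Type*} (u : (H →L[ℂ] H) →ₗ[ℂ] OH I) : Prop :=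
  ∃ C : ℝ, ∀ (m : ℕ) (a : Matrix (Fin m) (Fin m) (H →L[ℂ] H)),
    OH.matrixNorm (a.map u) ≤ C * ‖CStarMatrix.ofMatrix a‖

end

noncomputable section

open scoped ComplexOrder TensorProduct

/-! ### Test vectors for the minimal norm. -/

section MinNorm

variable {H : Type*} [NormedAddCommGroup H] [InnerProductSpace ℂ H]

/-! Write M for `minNormConj x`. The hypothesis on `u` is a geometric mean of f(xx*) and f(x*x), and
AM-GM bounds it by (w⁻¹ f(xx*) + w f(x*x))/2 for any weight w > 0. No single w suits all of x, so
each x_i is split as ∑_j y_ij over the 2J+1 dyadic weights w_j = 2^j, |j| ≤ J, where 2^J ≥ n and J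
is of order log n. If ∑ w_j⁻¹ y_ij y_ij* + w_j y_ij* y_ij ≤ C·1, applying f gives ∑ ‖u(y_ij)‖² ≤
K²C/2. Cauchy–Schwarz in j then costs a factor 2J+1, which is the logarithm.

Such a splitting exists for every C > 7M (`exists_decomposition_weightedSq_le`). In finite
dimension, a minimax argument lets the splitting depend on a density matrix D. In an eigenbasis of D
with eigenvalues μ_k, the (k,l) entry of x_i goes to the j for which 2^j is close to √(μ_k/μ_l). The
weighted cost of that entry is then about √(μ_k μ_l) |x_i(k,l)|², and the sum of these is at most M,
as the unit vector ∑ √μ_k e_k ⊗ ē_k shows. Truncation at |j| ≤ J adds an error controlled by M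
because 2^J ≥ n. Compression to finite-dimensional subspaces and a weak operator limit give the
general case. -/

theorem minNormConj_nonneg {n : ℕ} (x : Fin n → (H →L[ℂ] H)) : 0 ≤ minNormConj x := by
  unfold minNormConj
  positivity

theorem norm_inner_sum_tensorOp_le {n : ℕ} (x : Fin n → (H →L[ℂ] H))
    (ξ η : HilbertTensor H (ConjSpace H)) :
    ‖∑ i, inner ℂ ξ (tensorOp (x i) (ConjSpace.conjOp (x i)) η)‖ ≤
      minNormConj x * ‖ξ‖ * ‖η‖ := by
  rw [← inner_sum, ← sum_apply]
  refine (norm_inner_le_norm _ _).trans ?_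
  rw [mul_comm (minNormConj x), mul_assoc]
  exact mul_le_mul_of_nonneg_left (ContinuousLinearMap.le_opNorm _ _) (norm_nonneg _)

theorem inner_tensorOp_conjOp (a : H →L[ℂ] H) (h k h' k' : H) :
    inner ℂ ((h ⊗ₜ[ℂ] ConjSpace.mk h' : H ⊗[ℂ] ConjSpace H) : HilbertTensor H (ConjSpace H))
      (tensorOp a (ConjSpace.conjOp a)
        ((k ⊗ₜ[ℂ] ConjSpace.mk k' : H ⊗[ℂ] ConjSpace H) : HilbertTensor H (ConjSpace H))) =
      inner ℂ h (a k) * (starRingEnd ℂ) (inner ℂ h' (a k')) := by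
  rw [tensorOp_tmul, UniformSpace.Completion.inner_coe, TensorProduct.inner_tmul,
    ConjSpace.conjOp_mk, ConjSpace.inner_def, inner_conj_symm]
  rfl

theorem sum_norm_inner_sq_le_minNormConj {n : ℕ} (x : Fin n → (H →L[ℂ] H)) (h k : H) :
    ∑ i, ‖inner ℂ h (x i k)‖ ^ 2 ≤ minNormConj x * ‖h‖ ^ 2 * ‖k‖ ^ 2 := by
  have := norm_inner_sum_tensorOp_le x
    ((h ⊗ₜ[ℂ] ConjSpace.mk h : H ⊗[ℂ] ConjSpace H) : HilbertTensor H (ConjSpace H))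
    ((k ⊗ₜ[ℂ] ConjSpace.mk k : H ⊗[ℂ] ConjSpace H) : HilbertTensor H (ConjSpace H))
  simp only [inner_tensorOp_conjOp, UniformSpace.Completion.norm_coe, TensorProduct.norm_tmul,
    Complex.mul_conj, Complex.normSq_eq_norm_sq] at this
  rw [← Complex.ofReal_sum, Complex.norm_real, Real.norm_of_nonneg (by positivity)] at this
  rw [sq ‖h‖, sq ‖k‖]
  exact this

/-- Testing on h ⊗ h̄ and k ⊗ k̄ makes every summand nonnegative, so each one is dominated by the
sum. This controls the truncation error later. -/
theorem norm_sq_le_minNormConj {n : ℕ} (x : Fin n → (H →L[ℂ] H)) (i : Fin n) :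
    ‖x i‖ ^ 2 ≤ minNormConj x := by
  have h0 := minNormConj_nonneg x
  refine (Real.le_sqrt (norm_nonneg _) h0).mp ?_
  refine ContinuousLinearMap.opNorm_le_of_re_inner_le (Real.sqrt_nonneg _) fun k h => ?_
  intro hk hh
  have h1 := sum_norm_inner_sq_le_minNormConj x h k
  rw [hk, hh, one_pow, mul_one, mul_one] at h1
  have h2 := (Finset.single_le_sum (f := fun i => ‖inner ℂ h (x i k)‖ ^ 2)
    (fun i _ => by positivity) (Finset.mem_univ i)).trans h1
  rw [← norm_inner_symm] at h2
  exact (RCLike.re_le_norm _).trans (Real.le_sqrt_of_sq_le h2)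

/-- The left side is the diagonal coefficient of ∑ x_i ⊗ x̄_i at ξ = ∑ √w_k e_k ⊗ ē_k, a unit vector
because ∑ w_k = 1. Orthonormality without completeness suffices, so `e` may span a proper subspace.
-/
theorem sum_sqrt_mul_norm_inner_sq_le {n N : ℕ} (x : Fin n → (H →L[ℂ] H)) {e : Fin N → H}
    (he : Orthonormal ℂ e) {w : Fin N → ℝ} (hw : ∀ k, 0 ≤ w k) (hw1 : ∑ k, w k = 1) :
    ∑ i, ∑ k, ∑ l, Real.sqrt (w k * w l) * ‖inner ℂ (e k) (x i (e l))‖ ^ 2 ≤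
      minNormConj x := by
  let ξ : H ⊗[ℂ] ConjSpace H := ∑ k, ((Real.sqrt (w k) : ℂ) • e k) ⊗ₜ[ℂ] ConjSpace.mk (e k)
  have he' : Orthonormal ℂ (fun k => ConjSpace.mk (e k)) := by
    rw [orthonormal_iff_ite] at he ⊢
    intro k l
    rw [ConjSpace.inner_def]
    refine (he l k).trans ?_
    simp only [eq_comm]
  have hξ : ‖(ξ : HilbertTensor H (ConjSpace H))‖ = 1 := by
    rw [UniformSpace.Completion.norm_coe, ← sq_eq_sq₀ (norm_nonneg _) zero_le_one,
      norm_sum_tmul_orthonormal he', one_pow, ← hw1]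
    refine Finset.sum_congr rfl fun k _ => ?_
    rw [norm_smul, he.1 k, Complex.norm_real, Real.norm_of_nonneg (Real.sqrt_nonneg _), mul_one,
      Real.sq_sqrt (hw k)]
  have key := norm_inner_sum_tensorOp_le x ξ ξ
  have hsum : ∑ i, inner ℂ (ξ : HilbertTensor H (ConjSpace H))
      (tensorOp (x i) (ConjSpace.conjOp (x i)) ξ) =
      ((∑ i, ∑ k, ∑ l, Real.sqrt (w k * w l) * ‖inner ℂ (e k) (x i (e l))‖ ^ 2 : ℝ) : ℂ) := by
    rw [Complex.ofReal_sum]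
    refine Finset.sum_congr rfl fun i _ => ?_
    have hc : (ξ : HilbertTensor H (ConjSpace H)) = ∑ k, (Real.sqrt (w k) : ℂ) •
        ((e k ⊗ₜ[ℂ] ConjSpace.mk (e k) : H ⊗[ℂ] ConjSpace H) :
          HilbertTensor H (ConjSpace H)) := by
      have := map_sum (UniformSpace.Completion.toComplL (𝕜 := ℂ) (E := H ⊗[ℂ] ConjSpace H))
        (fun k => ((Real.sqrt (w k) : ℂ) • e k) ⊗ₜ[ℂ] ConjSpace.mk (e k)) Finset.univ
      simp only [ξ, ← TensorProduct.smul_tmul']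
      simpa only [UniformSpace.Completion.coe_toComplL, ← TensorProduct.smul_tmul',
        UniformSpace.Completion.coe_smul] using this
    simp only [hc, map_sum, map_smul, sum_inner, inner_sum, inner_smul_left, inner_smul_right,
      inner_tensorOp_conjOp, Complex.mul_conj, Complex.normSq_eq_norm_sq, Complex.conj_ofReal]
    rw [Finset.sum_comm, Complex.ofReal_sum]
    refine Finset.sum_congr rfl fun k _ => ?_
    rw [Complex.ofReal_sum, Finset.mul_sum]
    refine Finset.sum_congr rfl fun l _ => ?_
    rw [Real.sqrt_mul (hw l)]
    push_cast
    ring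
  rw [hsum, hξ, Complex.norm_real, mul_one, mul_one] at key
  exact (Real.le_norm_self _).trans key

end MinNorm

/-! ### Choice of a dyadic weight. -/

/-- The optimal weight is √(a/b). Rounding it down to a power of 2 loses a factor 2 in the first
term only, whence 3 = 2 + 1. When the ratio is out of range, the extreme weight makes both terms at
most 2^(-J) max(a, b). -/
theorem exists_zpow_two_mul_add_le (J : ℕ) {a b : ℝ} (ha : 0 ≤ a) (hb : 0 ≤ b) :
    ∃ j ∈ Finset.Icc (-(J : ℤ)) J,
      ((2 : ℝ) ^ j)⁻¹ * a + 2 ^ j * b ≤ 3 * Real.sqrt (a * b) + 2 / 2 ^ J * (a + b) := by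
  have hs := Real.sqrt_nonneg (a * b)
  have hP : (0 : ℝ) < 2 ^ J := by positivity
  by_cases h1 : 4 ^ J * b ≤ a
  · refine ⟨J, by simp, ?_⟩
    have h4 : (4 : ℝ) ^ J = 2 ^ J * 2 ^ J := by rw [← mul_pow]; norm_num
    have : (2 : ℝ) ^ J * b ≤ (2 ^ J)⁻¹ * a := by
      rw [inv_mul_eq_div, le_div_iff₀ hP]; rw [h4] at h1; linarith
    have hb' : 0 ≤ (2 ^ J : ℝ)⁻¹ * b := by positivity
    rw [zpow_natCast, div_eq_mul_inv]
    linarith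
  by_cases h2 : 4 ^ J * a ≤ b
  · refine ⟨-J, by simp, ?_⟩
    have h4 : (4 : ℝ) ^ J = 2 ^ J * 2 ^ J := by rw [← mul_pow]; norm_num
    have : (2 : ℝ) ^ J * a ≤ (2 ^ J)⁻¹ * b := by
      rw [inv_mul_eq_div, le_div_iff₀ hP]; rw [h4] at h2; linarith
    have hb' : 0 ≤ (2 ^ J : ℝ)⁻¹ * a := by positivity
    rw [zpow_neg, inv_inv, zpow_natCast, div_eq_mul_inv]
    linarith
  push Not at h1 h2
  have hb0 : 0 < b := by
    rcases hb.eq_or_lt with rfl | h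
    · simp at h1; linarith
    · exact h
  have ha0 : 0 < a := by
    rcases ha.eq_or_lt with rfl | h
    · simp at h2; linarith
    · exact h
  have h2J : ∀ c : ℝ, Real.sqrt (4 ^ J * c) = 2 ^ J * Real.sqrt c := fun c => by
    rw [Real.sqrt_mul (by positivity), show (4 : ℝ) ^ J = (2 ^ J) ^ 2 by
      rw [← pow_mul, mul_comm, pow_mul]; norm_num, Real.sqrt_sq hP.le]
  have h1' := Real.sqrt_lt_sqrt ha h1
  have h2' := Real.sqrt_lt_sqrt hb h2
  rw [h2J] at h1' h2'
  have hab := Real.sqrt_mul ha b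
  rw [← Real.mul_self_sqrt ha, ← Real.mul_self_sqrt hb, Real.mul_self_sqrt ha,
    Real.mul_self_sqrt hb, hab]
  have hs0 := Real.sqrt_pos.mpr ha0
  have ht0 := Real.sqrt_pos.mpr hb0
  have hsa := Real.mul_self_sqrt ha
  have hsb := Real.mul_self_sqrt hb
  generalize Real.sqrt a = s at *
  generalize Real.sqrt b = t at *
  have hr : 0 < s / t := by positivity
  have hlo := Int.zpow_log_le_self (b := 2) one_lt_two hr
  have hhi := Int.lt_zpow_succ_log_self (R := ℝ) (b := 2) one_lt_two (s / t)
  -- With s = √a and t = √b, this j satisfies 2^j ≤ s/t < 2^(j+1).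
  generalize Int.log 2 (s / t) = j at *
  push_cast at hlo hhi
  refine ⟨j, ?_, ?_⟩
  · rw [Finset.mem_Icc]
    constructor
    · have : (2 : ℝ) ^ (-(J : ℤ)) < 2 ^ (j + 1) := by
        refine lt_trans ?_ hhi
        rw [zpow_neg, zpow_natCast, lt_div_iff₀ ht0, inv_mul_lt_iff₀ hP]
        exact h2'
      have := (zpow_lt_zpow_iff_right₀ (one_lt_two : (1 : ℝ) < 2)).mp this
      omega
    · have : (2 : ℝ) ^ j < 2 ^ (J : ℤ) := by
        refine hlo.trans_lt ?_
        rw [zpow_natCast, div_lt_iff₀ ht0]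
        exact h1'
      exact ((zpow_lt_zpow_iff_right₀ (one_lt_two : (1 : ℝ) < 2)).mp this).le
  · have hj : (0 : ℝ) < 2 ^ j := by positivity
    rw [le_div_iff₀ ht0] at hlo
    rw [zpow_add_one₀ two_ne_zero, div_lt_iff₀ ht0] at hhi
    have e1 : ((2 : ℝ) ^ j)⁻¹ * a ≤ 2 * (s * t) := by
      rw [inv_mul_le_iff₀ hj, ← hsa]
      nlinarith
    have e2 : (2 : ℝ) ^ j * b ≤ s * t := by
      rw [← hsb]
      nlinarith
    have e3 : 0 ≤ 2 / 2 ^ J * (a + b) := by positivity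
    linarith

/-! ### Weighted row and column squares, and their convexity. -/

section WeightedSquares

variable {E : Type*} [NormedAddCommGroup E] [InnerProductSpace ℂ E] [CompleteSpace E]
  {α ι : Type*} [Fintype α] [Fintype ι]

/-- The operator `∑ᵢⱼ wⱼ⁻¹ yᵢⱼ yᵢⱼ* + wⱼ yᵢⱼ* yᵢⱼ`. -/
def weightedOp (w : ι → ℝ) (y : α → ι → (E →L[ℂ] E)) : E →L[ℂ] E :=
  ∑ i, ∑ j, ((((w j)⁻¹ : ℝ) : ℂ) • (y i j * star (y i j)) + (w j : ℂ) • (star (y i j) * y i j))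

/-- The quadratic form of `weightedOp w y`. -/
def weightedSq (w : ι → ℝ) (y : α → ι → (E →L[ℂ] E)) (h : E) : ℝ :=
  ∑ i, ∑ j, ((w j)⁻¹ * ‖star (y i j) h‖ ^ 2 + w j * ‖y i j h‖ ^ 2)

theorem inner_weightedOp (w : ι → ℝ) (y : α → ι → (E →L[ℂ] E)) (h : E) :
    inner ℂ h (weightedOp w y h) = (weightedSq w y h : ℂ) := by
  have h1 (a : E →L[ℂ] E) : inner ℂ h (a (star a h)) = ((‖star a h‖ ^ 2 : ℝ) : ℂ) := by
    rw [ContinuousLinearMap.star_eq_adjoint, ← ContinuousLinearMap.adjoint_inner_left]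
    simp
  have h2 (a : E →L[ℂ] E) : inner ℂ h (star a (a h)) = ((‖a h‖ ^ 2 : ℝ) : ℂ) := by
    simpa only [star_star] using h1 (star a)
  unfold weightedOp weightedSq
  simp [sum_apply, h1, h2]

theorem convexOn_norm_sq_apply {F : Type*} [NormedAddCommGroup F] [NormedSpace ℝ F]
    {G : Type*} [AddCommGroup G] [Module ℝ G] (L : G →ₗ[ℝ] F) (s : Set G) (hs : Convex ℝ s) :
    ConvexOn ℝ s (fun y => ‖L y‖ ^ 2) :=
  ((convexOn_norm (convex_univ (𝕜 := ℝ) (E := F))).comp_linearMap L |>.subset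
    (Set.subset_univ s) hs).pow (fun _ _ => norm_nonneg _) 2

theorem convexOn_sum {G κ : Type*} [AddCommGroup G] [Module ℝ G] {s : Set G} (hs : Convex ℝ s)
    (t : Finset κ) {g : κ → G → ℝ} (hg : ∀ k, ConvexOn ℝ s (g k)) :
    ConvexOn ℝ s (fun y => ∑ k ∈ t, g k y) := by
  classical
  induction t using Finset.induction_on with
  | empty => simpa using convexOn_const (0 : ℝ) hs
  | insert a t ha ih =>
    simp only [Finset.sum_insert ha]
    exact (hg a).add ih

theorem convexOn_weightedSq {w : ι → ℝ} (hw : ∀ j, 0 < w j) (h : E)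
    {s : Set (α → ι → (E →L[ℂ] E))} (hs : Convex ℝ s) :
    ConvexOn ℝ s (fun y => weightedSq w y h) := by
  refine convexOn_sum hs _ fun i => convexOn_sum hs _ fun j => ?_
  refine ConvexOn.add (f := fun y : α → ι → (E →L[ℂ] E) => (w j)⁻¹ * ‖star (y i j) h‖ ^ 2)
    (g := fun y : α → ι → (E →L[ℂ] E) => w j * ‖y i j h‖ ^ 2) ?_ ?_
  · refine ConvexOn.smul (inv_nonneg.mpr (hw j).le) ?_
    -- Real scalars are needed: y ↦ y* h is only conjugate-linear over ℂ.
    exact convexOn_norm_sq_apply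
      ({ toFun := fun y => star (y i j) h
         map_add' := by intro a b; simp
         map_smul' := by intro c a; simp } : (α → ι → (E →L[ℂ] E)) →ₗ[ℝ] E) s hs
  · refine ConvexOn.smul (hw j).le ?_
    exact convexOn_norm_sq_apply
      ({ toFun := fun y => y i j h
         map_add' := by intro a b; simp
         map_smul' := by intro c a; simp } : (α → ι → (E →L[ℂ] E)) →ₗ[ℝ] E) s hs

end WeightedSquares

/-! ### Splitting for a fixed density matrix. -/

section FiniteDimensional

variable {V : Type*} [NormedAddCommGroup V] [InnerProductSpace ℂ V] [FiniteDimensional ℂ V]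
  [CompleteSpace V]
  {ι : Type*} [Fintype ι]

/-- The main term contributes 3M. For each i the error term is a μ-average of row sums plus one of
column sums, hence at most 2δM; over n indices this is at most 4M. -/
theorem sum_weighted_le {n N : ℕ} {M δ : ℝ} (hδ : 0 ≤ δ) (hδn : δ * n ≤ 2) {μ : Fin N → ℝ}
    (hμ : ∀ k, 0 ≤ μ k) (hμ1 : ∑ k, μ k = 1) {m : Fin n → Fin N → Fin N → ℝ}
    (hm : ∀ i k l, 0 ≤ m i k l) (hrow : ∀ i k, ∑ l, m i k l ≤ M)
    (hcol : ∀ i l, ∑ k, m i k l ≤ M) {s c : Fin N → Fin N → ℝ}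
    (hs : ∑ i, ∑ k, ∑ l, s k l * m i k l ≤ M)
    (hc : ∀ k l, c k l ≤ 3 * s k l + δ * (μ k + μ l)) :
    ∑ i, ∑ k, ∑ l, m i k l * c k l ≤ 7 * M := by
  have hM : n = 0 → 0 ≤ M := by
    rintro rfl
    simpa using hs
  have hN : 0 < N := by
    rcases N.eq_zero_or_pos with rfl | h
    · simp at hμ1
    · exact h
  have hM0 : 0 ≤ M := by
    rcases n.eq_zero_or_pos with h | h
    · exact hM h
    · exact (Finset.sum_nonneg fun l _ => hm ⟨0, h⟩ ⟨0, hN⟩ l).trans (hrow ⟨0, h⟩ ⟨0, hN⟩)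
  have h1 (i : Fin n) : ∑ k, ∑ l, m i k l * c k l ≤
      3 * (∑ k, ∑ l, s k l * m i k l) + δ * (2 * M) := by
    have e1 : ∑ k, μ k * ∑ l, m i k l ≤ M := by
      refine (Finset.sum_le_sum fun k _ =>
        mul_le_mul_of_nonneg_left (hrow i k) (hμ k)).trans ?_
      rw [← Finset.sum_mul, hμ1, one_mul]
    have e2 : ∑ l, μ l * ∑ k, m i k l ≤ M := by
      refine (Finset.sum_le_sum fun l _ =>
        mul_le_mul_of_nonneg_left (hcol i l) (hμ l)).trans ?_
      rw [← Finset.sum_mul, hμ1, one_mul]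
    have e3 : ∑ k, ∑ l, m i k l * (3 * s k l + δ * (μ k + μ l)) =
        3 * (∑ k, ∑ l, s k l * m i k l) +
          δ * (∑ k, μ k * ∑ l, m i k l + ∑ l, μ l * ∑ k, m i k l) := by
      simp only [Finset.mul_sum, mul_add]
      rw [Finset.sum_comm (f := fun l k => δ * (μ l * m i k l))]
      simp only [← Finset.sum_add_distrib]
      refine Finset.sum_congr rfl fun k _ => Finset.sum_congr rfl fun l _ => ?_
      ring
    calc _ ≤ ∑ k, ∑ l, m i k l * (3 * s k l + δ * (μ k + μ l)) :=
          Finset.sum_le_sum fun k _ => Finset.sum_le_sum fun l _ =>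
            mul_le_mul_of_nonneg_left (hc k l) (hm i k l)
      _ ≤ _ := by
          rw [e3]
          have := mul_le_mul_of_nonneg_left (add_le_add e1 e2) hδ
          linarith
  refine (Finset.sum_le_sum fun i _ => h1 i).trans ?_
  rw [Finset.sum_add_distrib, ← Finset.mul_sum]
  simp only [Finset.sum_const, Finset.card_univ, Fintype.card_fin, nsmul_eq_mul]
  nlinarith

/-- Each matrix entry is assigned to exactly one j, so the cost averaged over μ becomes a sum over
entries of |x_i(k,l)|² (w_j⁻¹ μ_k + w_j μ_l) with j = J k l. -/
theorem exists_blockDecomposition {n N : ℕ} {M δ : ℝ} {w : ι → ℝ}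
    (hδ : 0 ≤ δ) (hδn : δ * n ≤ 2)
    (hwδ : ∀ a b : ℝ, 0 ≤ a → 0 ≤ b →
      ∃ j, (w j)⁻¹ * a + w j * b ≤ 3 * Real.sqrt (a * b) + δ * (a + b))
    (x : Fin n → (V →L[ℂ] V)) (hx : ∀ i, ‖x i‖ ^ 2 ≤ M)
    (b : OrthonormalBasis (Fin N) ℂ V) {μ : Fin N → ℝ} (hμ : ∀ k, 0 ≤ μ k) (hμ1 : ∑ k, μ k = 1)
    (hxμ : ∑ i, ∑ k, ∑ l, Real.sqrt (μ k * μ l) * ‖inner ℂ (b k) (x i (b l))‖ ^ 2 ≤ M) :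
    ∃ y : Fin n → ι → (V →L[ℂ] V), (∀ i, ∑ j, y i j = x i) ∧
      ∑ k, μ k * weightedSq w y (b k) ≤ 7 * M := by
  classical
  choose J hJ using fun k l => hwδ (μ k) (μ l) (hμ k) (hμ l)
  -- `y i j` keeps the entries (k,l) of `x i` with J k l = j and replaces the others by 0.
  let y : Fin n → ι → (V →L[ℂ] V) := fun i j => LinearMap.toContinuousLinearMap
    (b.toBasis.constr ℂ fun l => ∑ k, if J k l = j then inner ℂ (b k) (x i (b l)) • b k else 0)
  have hyb (i j l) : y i j (b l) =
      ∑ k, if J k l = j then inner ℂ (b k) (x i (b l)) • b k else 0 := by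
    have := b.toBasis.constr_basis ℂ
      (fun l => ∑ k, if J k l = j then inner ℂ (b k) (x i (b l)) • b k else 0) l
    rwa [OrthonormalBasis.coe_toBasis] at this
  have hin (i j k l) : inner ℂ (b k) (y i j (b l)) =
      if J k l = j then inner ℂ (b k) (x i (b l)) else 0 := by
    rw [hyb, inner_sum, Finset.sum_eq_single k]
    · split_ifs <;> simp [inner_smul_right]
    · intro k' _ hk'
      split_ifs
      · rw [inner_smul_right, b.inner_eq_zero hk'.symm, mul_zero]
      · simp
    · simp
  refine ⟨y, fun i => ?_, ?_⟩
  · refine ContinuousLinearMap.coe_injective (b.toBasis.ext fun l => ?_)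
    rw [OrthonormalBasis.coe_toBasis]
    refine InnerProductSpace.ext_inner_left_basis b.toBasis fun k => ?_
    rw [OrthonormalBasis.coe_toBasis]
    simp [inner_sum, hin]
  let m : Fin n → Fin N → Fin N → ℝ := fun i k l => ‖inner ℂ (b k) (x i (b l))‖ ^ 2
  have hm (i k l) : 0 ≤ m i k l := by positivity
  have hM (a : V →L[ℂ] V) (i : Fin n) (ha : ‖a‖ = ‖x i‖) (k : Fin N) : ‖a (b k)‖ ^ 2 ≤ M := by
    refine le_trans ?_ (hx i)
    rw [← ha]
    exact pow_le_pow_left₀ (norm_nonneg _) (a.unit_le_opNorm _ (b.norm_eq_one k).le) 2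
  have hrow (a : V →L[ℂ] V) (k) : ‖star a (b k)‖ ^ 2 = ∑ l, ‖inner ℂ (b k) (a (b l))‖ ^ 2 := by
    rw [← b.sum_sq_norm_inner_left]
    refine Finset.sum_congr rfl fun l _ => ?_
    rw [ContinuousLinearMap.star_eq_adjoint, ContinuousLinearMap.adjoint_inner_left]
  have hcol (a : V →L[ℂ] V) (l) : ‖a (b l)‖ ^ 2 = ∑ k, ‖inner ℂ (b k) (a (b l))‖ ^ 2 :=
    (b.sum_sq_norm_inner_right _).symm
  have hn (i j k l) : ‖inner ℂ (b k) (y i j (b l))‖ ^ 2 = if J k l = j then m i k l else 0 := by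
    rw [hin]
    split_ifs <;> simp [m]
  have hrow' (i k) : ∑ l, m i k l ≤ M := by
    rw [← hrow]
    exact hM _ i (norm_star _) k
  have hcol' (i l) : ∑ k, m i k l ≤ M := by
    rw [← hcol]
    exact hM _ i rfl l
  have e1 : ∑ k, μ k * weightedSq w y (b k) =
      ∑ i, ∑ k, ∑ l, m i k l * ((w (J k l))⁻¹ * μ k + w (J k l) * μ l) := by
    have e2 : ∑ k, μ k * weightedSq w y (b k) =
        ∑ i, ((∑ k, ∑ j, μ k * ((w j)⁻¹ * ‖star (y i j) (b k)‖ ^ 2)) +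
          ∑ l, ∑ j, μ l * (w j * ‖y i j (b l)‖ ^ 2)) := by
      simp only [weightedSq, Finset.mul_sum, mul_add, Finset.sum_add_distrib]
      congr 1 <;> exact Finset.sum_comm
    rw [e2]
    refine Finset.sum_congr rfl fun i _ => ?_
    simp only [hrow, hcol, hn, mul_add, Finset.sum_add_distrib, Finset.mul_sum]
    congr 1
    · refine Finset.sum_congr rfl fun k _ => ?_
      rw [Finset.sum_comm]
      refine Finset.sum_congr rfl fun l _ => ?_
      simp
      ring
    · rw [Finset.sum_comm (f := fun k l => m i k l * (w (J k l) * μ l))]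
      refine Finset.sum_congr rfl fun l _ => ?_
      rw [Finset.sum_comm]
      refine Finset.sum_congr rfl fun k _ => ?_
      simp
      ring
  rw [e1]
  exact sum_weighted_le hδ hδn hμ hμ1 hm hrow' hcol' hxμ hJ

end FiniteDimensional

/-! ### Minimax over density operators. -/

section Minimax

/-- The sets {x | t < f x y} are open, so by compactness finitely many y serve all of X; this is the
finite form to which Sion's theorem applies. -/
theorem exists_forall_lt_of_forall_exists_lt {E F : Type*}
    [TopologicalSpace E] [AddCommGroup E] [Module ℝ E] [IsTopologicalAddGroup E]
    [ContinuousSMul ℝ E] [TopologicalSpace F] [AddCommGroup F] [Module ℝ F]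
    [IsTopologicalAddGroup F] [ContinuousSMul ℝ F] {X : Set E} {Y : Set F} {f : E → F → ℝ} {t : ℝ}
    (hX : X.Nonempty) (hXc : Convex ℝ X) (hXk : IsCompact X) (hYc : Convex ℝ Y)
    (hfy : ∀ y, Continuous fun x => f x y) (hfy' : ∀ y ∈ Y, QuasiconvexOn ℝ X fun x => f x y)
    (hfx : ∀ x, Continuous fun y => f x y) (hfx' : ∀ x ∈ X, QuasiconcaveOn ℝ Y fun y => f x y)
    (h : ∀ x ∈ X, ∃ y ∈ Y, t < f x y) : ∃ y ∈ Y, ∀ x ∈ X, t < f x y := by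
  classical
  choose! g hgY hg using h
  obtain ⟨s, hsX, hs⟩ := hXk.elim_nhds_subcover (fun x => {x' | t < f x' (g x)})
    fun x hx => (isOpen_lt continuous_const (hfy (g x))).mem_nhds (hg x hx)
  refine Sion.exists_lt_iInf_of_lt_iInf_of_finite hX hXk
    (fun y _ => (hfy y).lowerSemicontinuous.lowerSemicontinuousOn X) hfy' hYc
    (fun x _ => (hfx x).upperSemicontinuous.upperSemicontinuousOn Y) hfx' hXc
    (s := g '' s) (s.finite_toSet.image g) ?_ ?_
  · rintro _ ⟨x, hx, rfl⟩
    exact hgY x (hsX x hx)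
  · intro x hx
    obtain ⟨x', hx', hlt⟩ := Set.mem_iUnion₂.mp (hs hx)
    exact ⟨g x', ⟨x', hx', rfl⟩, hlt⟩

variable {V : Type*} [NormedAddCommGroup V] [InnerProductSpace ℂ V] [FiniteDimensional ℂ V]
  [CompleteSpace V]

variable (V) in
/-- The trace on the bounded operators of a finite-dimensional space. -/
def clmTrace : (V →L[ℂ] V) →ₗ[ℂ] ℂ :=
  LinearMap.trace ℂ V ∘ₗ ContinuousLinearMap.coeLM ℂ

omit [CompleteSpace V] in
theorem continuous_clmTrace : Continuous (clmTrace V) :=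
  LinearMap.continuous_of_finiteDimensional _

omit [FiniteDimensional ℂ V] [CompleteSpace V] in
theorem clmTrace_eq_sum_inner {N : ℕ} (b : OrthonormalBasis (Fin N) ℂ V) (T : V →L[ℂ] V) :
    clmTrace V T = ∑ k, inner ℂ (b k) (T (b k)) :=
  LinearMap.trace_eq_sum_inner (T : V →ₗ[ℂ] V) b

variable (V) in
/-- The density operators of a finite-dimensional Hilbert space. -/
def densityOps : Set (V →L[ℂ] V) := {D | 0 ≤ D ∧ (clmTrace V D).re = 1}

omit [FiniteDimensional ℂ V] in
theorem convex_densityOps : Convex ℝ (densityOps V) := by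
  rintro D ⟨hD, hD1⟩ D' ⟨hD', hD1'⟩ a b ha hb hab
  refine ⟨?_, ?_⟩
  · have h1 : (0 : V →L[ℂ] V) ≤ a • D := smul_nonneg ha hD
    have h2 : (0 : V →L[ℂ] V) ≤ b • D' := smul_nonneg hb hD'
    exact add_nonneg h1 h2
  · rw [← Complex.coe_smul a, ← Complex.coe_smul b, map_add, map_smul, map_smul]
    simp [hD1, hD1', hab]

omit [CompleteSpace V] in
theorem exists_eigenbasis_of_mem_densityOps {D : V →L[ℂ] V} (hD : D ∈ densityOps V) :
    ∃ (N : ℕ) (b : OrthonormalBasis (Fin N) ℂ V) (μ : Fin N → ℝ), (∀ k, 0 ≤ μ k) ∧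
      ∑ k, μ k = 1 ∧ ∀ k, D (b k) = (μ k : ℂ) • b k := by
  have hpos := (ContinuousLinearMap.isPositive_toLinearMap_iff D).mpr
    ((ContinuousLinearMap.nonneg_iff_isPositive D).mp hD.1)
  refine ⟨_, hpos.isSymmetric.eigenvectorBasis rfl, hpos.isSymmetric.eigenvalues rfl,
    hpos.nonneg_eigenvalues rfl, ?_, fun k => hpos.isSymmetric.apply_eigenvectorBasis rfl k⟩
  rw [← hpos.isSymmetric.re_trace_eq_sum_eigenvalues rfl]
  exact hD.2

theorem isCompact_densityOps : IsCompact (densityOps V) := by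
  have : ProperSpace (V →L[ℂ] V) := FiniteDimensional.proper ℂ _
  refine Metric.isCompact_of_isClosed_isBounded ?_ ?_
  · exact isClosed_Ici.inter
      (isClosed_eq (Complex.continuous_re.comp continuous_clmTrace) continuous_const)
  · refine (Metric.isBounded_closedBall (x := (0 : V →L[ℂ] V)) (r := 1)).subset fun D hD => ?_
    rw [mem_closedBall_zero_iff]
    obtain ⟨N, b, μ, hμ, hμ1, hb⟩ := exists_eigenbasis_of_mem_densityOps hD
    refine ContinuousLinearMap.opNorm_le_bound _ zero_le_one fun v => ?_
    rw [one_mul, ← sq_le_sq₀ (norm_nonneg _) (norm_nonneg _), ← b.sum_sq_norm_inner_right,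
      ← b.sum_sq_norm_inner_right v]
    refine Finset.sum_le_sum fun k _ => ?_
    have hsym : inner ℂ (b k) (D v) = (μ k : ℂ) * inner ℂ (b k) v := by
      rw [← ((ContinuousLinearMap.nonneg_iff_isPositive D).mp hD.1).inner_left_eq_inner_right, hb,
        inner_smul_left, Complex.conj_ofReal]
    have hk : μ k ≤ 1 := hμ1 ▸ Finset.single_le_sum (fun l _ => hμ l) (Finset.mem_univ k)
    rw [hsym, norm_mul, Complex.norm_real, Real.norm_of_nonneg (hμ k)]
    refine pow_le_pow_left₀ (by have := hμ k; positivity) ?_ 2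
    exact mul_le_of_le_one_left (norm_nonneg _) hk

omit [FiniteDimensional ℂ V] [CompleteSpace V] in
theorem clmTrace_mul_eq_sum {D : V →L[ℂ] V} (hD : D ∈ densityOps V) {N : ℕ}
    {b : OrthonormalBasis (Fin N) ℂ V} {μ : Fin N → ℝ} (hb : ∀ k, D (b k) = (μ k : ℂ) • b k)
    (T : V →L[ℂ] V) : clmTrace V (D * T) = ∑ k, (μ k : ℂ) * inner ℂ (b k) (T (b k)) := by
  rw [clmTrace_eq_sum_inner b]
  refine Finset.sum_congr rfl fun k _ => ?_
  rw [mul_apply_eq_comp,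
    ← ((ContinuousLinearMap.nonneg_iff_isPositive D).mp hD.1).inner_left_eq_inner_right, hb,
    inner_smul_left, Complex.conj_ofReal]

/-- The rank-one projection onto h is the density. A trace bound against all densities thus becomes
a bound on the quadratic form. -/
theorem exists_mem_densityOps_clmTrace_mul {h : V} (hh : ‖h‖ = 1) :
    ∃ D ∈ densityOps V, ∀ T : V →L[ℂ] V, clmTrace V (D * T) = inner ℂ h (T h) := by
  have key (T : V →L[ℂ] V) :
      clmTrace V (InnerProductSpace.rankOne ℂ h h * T) = inner ℂ h (T h) := by
    have : InnerProductSpace.rankOne ℂ h h * T =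
        InnerProductSpace.rankOne ℂ h (ContinuousLinearMap.adjoint T h) := by
      ext v
      simp [ContinuousLinearMap.adjoint_inner_left]
    rw [this]
    refine (InnerProductSpace.trace_rankOne _ _).trans ?_
    rw [ContinuousLinearMap.adjoint_inner_left]
  refine ⟨InnerProductSpace.rankOne ℂ h h, ⟨?_, ?_⟩, key⟩
  · rw [ContinuousLinearMap.nonneg_iff_isPositive]
    exact InnerProductSpace.isPositive_rankOne_self h
  · have := key 1
    rw [mul_one] at this
    rw [this, one_apply_eq_self, inner_self_eq_norm_sq_to_K, hh]
    simp

variable {ι : Type*} [Fintype ι]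

theorem weightedSq_smul {E α : Type*} [NormedAddCommGroup E] [InnerProductSpace ℂ E]
    [CompleteSpace E] [Fintype α] (w : ι → ℝ) (y : α → ι → (E →L[ℂ] E)) (c : ℂ) (h : E) :
    weightedSq w y (c • h) = ‖c‖ ^ 2 * weightedSq w y h := by
  simp only [weightedSq, map_smul, norm_smul, Finset.mul_sum]
  refine Finset.sum_congr rfl fun i _ => Finset.sum_congr rfl fun j _ => ?_
  ring

/-- Minimax exchanges "for each density a splitting" for "one splitting for all densities": the
negated trace pairing is affine in D and concave in y. Since the exchange works with strict
inequalities, C must exceed 7M. -/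
theorem exists_decomposition_weightedSq_lt {n : ℕ} {M C δ : ℝ} {w : ι → ℝ} (hw : ∀ j, 0 < w j)
    (hδ : 0 ≤ δ) (hδn : δ * n ≤ 2)
    (hwδ : ∀ a b : ℝ, 0 ≤ a → 0 ≤ b →
      ∃ j, (w j)⁻¹ * a + w j * b ≤ 3 * Real.sqrt (a * b) + δ * (a + b))
    (x : Fin n → (V →L[ℂ] V)) (hx : ∀ i, ‖x i‖ ^ 2 ≤ M)
    (hxμ : ∀ (N : ℕ) (b : OrthonormalBasis (Fin N) ℂ V) (μ : Fin N → ℝ), (∀ k, 0 ≤ μ k) →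
      ∑ k, μ k = 1 →
      ∑ i, ∑ k, ∑ l, Real.sqrt (μ k * μ l) * ‖inner ℂ (b k) (x i (b l))‖ ^ 2 ≤ M)
    (hC : 7 * M < C) :
    ∃ y : Fin n → ι → (V →L[ℂ] V), (∀ i, ∑ j, y i j = x i) ∧
      ∀ h, weightedSq w y h ≤ C * ‖h‖ ^ 2 := by
  rcases subsingleton_or_nontrivial V with hV | hV
  -- On the zero space there are no densities, so minimax does not apply.
  · refine ⟨0, fun i => Subsingleton.elim _ _, fun h => ?_⟩
    rw [Subsingleton.elim h 0]
    simp [weightedSq]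
  let Y : Set (Fin n → ι → (V →L[ℂ] V)) := {y | ∀ i, ∑ j, y i j = x i}
  let f : (V →L[ℂ] V) → (Fin n → ι → (V →L[ℂ] V)) → ℝ :=
    fun D y => -(clmTrace V (D * weightedOp w y)).re
  have hf {D : V →L[ℂ] V} (hD : D ∈ densityOps V) {N : ℕ}
      {b : OrthonormalBasis (Fin N) ℂ V} {μ : Fin N → ℝ} (hb : ∀ k, D (b k) = (μ k : ℂ) • b k)
      (y) : f D y = -∑ k, μ k * weightedSq w y (b k) := by
    simp only [f, clmTrace_mul_eq_sum hD hb, inner_weightedOp]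
    simp
  have hYc : Convex ℝ Y := by
    intro y hy z hz a b _ _ hab i
    simp only [Pi.add_apply, Pi.smul_apply, Finset.sum_add_distrib, ← Finset.smul_sum, hy i, hz i,
      ← add_smul, hab, one_smul]
  obtain ⟨v, hv⟩ := exists_norm_eq V zero_le_one
  obtain ⟨y, hyY, hy⟩ := exists_forall_lt_of_forall_exists_lt (f := f) (t := -C) (Y := Y)
    ((exists_mem_densityOps_clmTrace_mul hv).imp fun D hD => hD.1) convex_densityOps
    isCompact_densityOps hYc
    (fun y => by
      have := continuous_clmTrace (V := V)
      fun_prop)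
    (fun y _ => by
      refine ConvexOn.quasiconvexOn ⟨convex_densityOps, fun D _ D' _ a b _ _ _ => le_of_eq ?_⟩
      simp only [f]
      rw [← Complex.coe_smul a, ← Complex.coe_smul b, add_mul, smul_mul_assoc, smul_mul_assoc,
        map_add, map_smul, map_smul]
      simp
      ring)
    (fun D => by
      have := continuous_clmTrace (V := V)
      unfold f weightedOp
      fun_prop)
    (fun D hD => by
      obtain ⟨N, b, μ, hμ, hμ1, hb⟩ := exists_eigenbasis_of_mem_densityOps hD
      refine ConcaveOn.quasiconcaveOn ?_
      simp only [hf hD hb]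
      exact (convexOn_sum hYc _ fun k => (convexOn_weightedSq hw (b k) hYc).smul (hμ k)).neg)
    (fun D hD => by
      obtain ⟨N, b, μ, hμ, hμ1, hb⟩ := exists_eigenbasis_of_mem_densityOps hD
      obtain ⟨y, hy, hyM⟩ := exists_blockDecomposition hδ hδn hwδ x hx b hμ hμ1 (hxμ N b μ hμ hμ1)
      refine ⟨y, hy, ?_⟩
      rw [hf hD hb]
      linarith)
  refine ⟨y, hyY, fun h => ?_⟩
  rcases eq_or_ne h 0 with rfl | hh
  · simp [weightedSq]
  have hh' : ‖h‖ ≠ 0 := norm_ne_zero_iff.mpr hh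
  have h1 : ‖((‖h‖ : ℂ)⁻¹) • h‖ = 1 := by
    rw [norm_smul]
    simp [hh']
  obtain ⟨D, hD, hDT⟩ := exists_mem_densityOps_clmTrace_mul h1
  have h2 := hy D hD
  simp only [f, hDT, inner_weightedOp, Complex.ofReal_re] at h2
  have h3 := weightedSq_smul w y (‖h‖ : ℂ) (((‖h‖ : ℂ)⁻¹) • h)
  rw [smul_smul, mul_inv_cancel₀ (by exact_mod_cast hh'), one_smul] at h3
  rw [h3, mul_comm C]
  simp only [Complex.norm_real, norm_norm]
  exact mul_le_mul_of_nonneg_left (by linarith) (sq_nonneg _)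

end Minimax

/-! ### Passage to arbitrary Hilbert spaces. -/

section WeakLimit

open Filter Topology

variable {H : Type*} [NormedAddCommGroup H] [InnerProductSpace ℂ H] [CompleteSpace H]

/-- Weak operator compactness of balls: the coefficients converge along the ultrafilter to a bounded
sesquilinear form, which is represented by an operator. -/
theorem exists_tendsto_inner_of_norm_le {α : Type*} (𝒰 : Ultrafilter α) (T : α → (H →L[ℂ] H))
    {R : ℝ} (hT : ∀ a, ‖T a‖ ≤ R) :
    ∃ S : H →L[ℂ] H, ∀ h k,
      Tendsto (fun a => inner ℂ k (T a h)) 𝒰 (𝓝 (inner ℂ k (S h))) := by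
  have hbound (h k : H) (a : α) : ‖inner ℂ (T a h) k‖ ≤ R * ‖h‖ * ‖k‖ :=
    (norm_inner_le_norm _ _).trans (mul_le_mul_of_nonneg_right
      ((T a).le_of_opNorm_le (hT a) h) (norm_nonneg _))
  have hlim (h k : H) : ∃ z : ℂ, ‖z‖ ≤ R * ‖h‖ * ‖k‖ ∧
      Tendsto (fun a => inner ℂ (T a h) k) 𝒰 (𝓝 z) := by
    obtain ⟨z, hz, hle⟩ := (isCompact_closedBall (0 : ℂ) (R * ‖h‖ * ‖k‖)).ultrafilter_le_nhds'
      (𝒰.map fun a => inner ℂ (T a h) k)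
      (mem_map.mpr (univ_mem' fun a => mem_closedBall_zero_iff.mpr (hbound h k a)))
    exact ⟨z, mem_closedBall_zero_iff.mp hz, hle⟩
  choose B hB hBlim using hlim
  let L : H →ₗ⋆[ℂ] H →ₗ[ℂ] ℂ := LinearMap.mk₂'ₛₗ (starRingEnd ℂ) (RingHom.id ℂ) B
    (fun h h' k => tendsto_nhds_unique (hBlim (h + h') k) <| by
      simpa only [map_add, inner_add_left] using (hBlim h k).add (hBlim h' k))
    (fun c h k => tendsto_nhds_unique (hBlim (c • h) k) <| by
      simpa only [map_smul, inner_smul_left, smul_eq_mul] using (hBlim h k).const_mul _)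
    (fun h k k' => tendsto_nhds_unique (hBlim h (k + k')) <| by
      simpa only [inner_add_right] using (hBlim h k).add (hBlim h k'))
    (fun c h k => tendsto_nhds_unique (hBlim h (c • k)) <| by
      simpa only [inner_smul_right, smul_eq_mul, RingHom.id_apply] using (hBlim h k).const_mul _)
  refine ⟨InnerProductSpace.continuousLinearMapOfBilin (L.mkContinuous₂ R hB), fun h k => ?_⟩
  have h1 := (Complex.continuous_conj.tendsto _).comp (hBlim h k)
  rw [← inner_conj_symm, InnerProductSpace.continuousLinearMapOfBilin_apply]
  refine h1.congr fun a => ?_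
  exact inner_conj_symm _ _

/-- Weak lower semicontinuity of a square norm. Pairing T a with its limit S and using AM-GM gives
Q(S) ≤ (C + Q(S))/2, where Q is the weighted square at h. -/
theorem weightedSq_le_of_tendsto_inner {α β ι : Type*} [Fintype β] [Fintype ι] {𝒰 : Ultrafilter α}
    {w : ι → ℝ} (hw : ∀ j, 0 < w j) {T : α → β → ι → (H →L[ℂ] H)} {S : β → ι → (H →L[ℂ] H)}
    (hTS : ∀ i j h k, Tendsto (fun a => inner ℂ k (T a i j h)) 𝒰 (𝓝 (inner ℂ k (S i j h))))
    {h : H} {C : ℝ} (hC : ∀ a, weightedSq w (T a) h ≤ C) : weightedSq w S h ≤ C := by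
  have hTS' (i j) (k : H) : Tendsto (fun a => inner ℂ k (star (T a i j) h)) 𝒰
      (𝓝 (inner ℂ k (star (S i j) h))) := by
    have h1 := (Complex.continuous_conj.tendsto _).comp (hTS i j k h)
    simp only [ContinuousLinearMap.star_eq_adjoint, ContinuousLinearMap.adjoint_inner_right]
    rw [inner_conj_symm] at h1
    exact h1.congr fun a => inner_conj_symm _ _
  have hre {f : α → ℂ} {z : ℂ} (hf : Tendsto f 𝒰 (𝓝 z)) :
      Tendsto (fun a => (f a).re) 𝒰 (𝓝 z.re) := (Complex.continuous_re.tendsto _).comp hf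
  have hself (v : H) : (inner ℂ v v).re = ‖v‖ ^ 2 := inner_self_eq_norm_sq (𝕜 := ℂ) v
  have hlim : Tendsto (fun a => ∑ i, ∑ j, ((w j)⁻¹ *
      (inner ℂ (star (S i j) h) (star (T a i j) h)).re + w j * (inner ℂ (S i j h) (T a i j h)).re))
      𝒰 (𝓝 (weightedSq w S h)) := by
    refine tendsto_finsetSum _ fun i _ => tendsto_finsetSum _ fun j _ => ?_
    have h1 := hre (hTS' i j (star (S i j) h))
    have h2 := hre (hTS i j h (S i j h))
    rw [hself] at h1 h2
    exact (h1.const_mul _).add (h2.const_mul _)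
  have hamgm (u v : H) : (inner ℂ u v).re ≤ (‖v‖ ^ 2 + ‖u‖ ^ 2) / 2 := by
    have h1 : (inner ℂ u v).re ≤ ‖u‖ * ‖v‖ := re_inner_le_norm (𝕜 := ℂ) u v
    nlinarith [sq_nonneg (‖u‖ - ‖v‖)]
  have hle : weightedSq w S h ≤ (C + weightedSq w S h) / 2 := by
    refine le_of_tendsto' hlim fun a => ?_
    refine le_trans ?_ (div_le_div_of_nonneg_right (add_le_add_left (hC a) _) two_pos.le)
    simp only [weightedSq, ← Finset.sum_add_distrib, Finset.sum_div]
    refine Finset.sum_le_sum fun i _ => Finset.sum_le_sum fun j _ => ?_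
    have h1 := mul_le_mul_of_nonneg_left (hamgm (star (S i j) h) (star (T a i j) h))
      (inv_nonneg.mpr (hw j).le)
    have h2 := mul_le_mul_of_nonneg_left (hamgm (S i j h) (T a i j h)) (hw j).le
    linarith
  linarith

variable {ι : Type*} [Fintype ι]

/-- Splits the compression of each x_i to V and extends the pieces by 0 on the orthogonal
complement. Compression preserves both inputs of the finite-dimensional case, the norm bounds and
the test-vector bound. -/
theorem exists_decomposition_on_submodule {n : ℕ} {C δ : ℝ} {w : ι → ℝ} (hw : ∀ j, 0 < w j)
    (hδ : 0 ≤ δ) (hδn : δ * n ≤ 2)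
    (hwδ : ∀ a b : ℝ, 0 ≤ a → 0 ≤ b →
      ∃ j, (w j)⁻¹ * a + w j * b ≤ 3 * Real.sqrt (a * b) + δ * (a + b))
    (x : Fin n → (H →L[ℂ] H)) (hC : 7 * minNormConj x < C) (V : Submodule ℂ H)
    [FiniteDimensional ℂ V] :
    ∃ y : Fin n → ι → (H →L[ℂ] H),
      (∀ i, ∀ h ∈ V, ∀ k ∈ V, inner ℂ k ((∑ j, y i j) h) = inner ℂ k (x i h)) ∧
      ∀ h, weightedSq w y h ≤ C * ‖h‖ ^ 2 := by
  let P : H →L[ℂ] V := V.orthogonalProjectionOnto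
  have hPn : ‖P‖ ≤ 1 := Submodule.orthogonalProjectionOnto_norm_le V
  have hin (u v : V) (a : H →L[ℂ] H) :
      inner ℂ u ((P ∘L a ∘L V.subtypeL) v) = inner ℂ (u : H) (a v) :=
    Submodule.inner_orthogonalProjectionOnto_eq_of_mem_left u (a v)
  obtain ⟨y, hyx, hy⟩ := exists_decomposition_weightedSq_lt (V := V) (M := minNormConj x) hw hδ hδn
    hwδ (fun i => P ∘L x i ∘L V.subtypeL)
    (fun i => by
      refine le_trans (pow_le_pow_left₀ (norm_nonneg _) ?_ 2) (norm_sq_le_minNormConj x i)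
      refine ContinuousLinearMap.opNorm_le_bound _ (norm_nonneg _) fun v => ?_
      refine (P.le_of_opNorm_le hPn _).trans ?_
      rw [one_mul]
      exact (x i).le_opNorm v)
    (fun N b μ hμ hμ1 => by
      simp only [hin]
      exact sum_sqrt_mul_norm_inner_sq_le x (b.orthonormal.comp_linearIsometry V.subtypeₗᵢ) hμ hμ1)
    hC
  refine ⟨fun i j => V.subtypeL ∘L y i j ∘L P, fun i h hh k hk => ?_, fun h => ?_⟩
  · have h1 : (∑ j, V.subtypeL ∘L y i j ∘L P) h = ((∑ j, y i j) (P h) : V) := by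
      simp [sum_apply]
    have h2 : P h = ⟨h, hh⟩ := V.orthogonalProjectionOnto_mem_subspace_eq_self ⟨h, hh⟩
    rw [h1, hyx, h2]
    exact hin ⟨k, hk⟩ ⟨h, hh⟩ (x i)
  · have h1 : weightedSq w (fun i j => V.subtypeL ∘L y i j ∘L P) h = weightedSq w y (P h) := by
      have hstar (a : V →L[ℂ] V) :
          star (V.subtypeL ∘L a ∘L P) = V.subtypeL ∘L star a ∘L P := by
        simp only [P, ContinuousLinearMap.star_eq_adjoint, ContinuousLinearMap.adjoint_comp,
          Submodule.adjoint_subtypeL, Submodule.adjoint_orthogonalProjectionOnto]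
        rfl
      simp [weightedSq, hstar]
    rw [h1]
    refine (hy (P h)).trans ?_
    have h0 := minNormConj_nonneg x
    have h2 : ‖P h‖ ≤ ‖h‖ := by simpa using P.le_of_opNorm_le hPn h
    gcongr
    linarith

theorem exists_decomposition_weightedSq_le {n : ℕ} {C δ : ℝ} {w : ι → ℝ} (hw : ∀ j, 0 < w j)
    (hδ : 0 ≤ δ) (hδn : δ * n ≤ 2)
    (hwδ : ∀ a b : ℝ, 0 ≤ a → 0 ≤ b →
      ∃ j, (w j)⁻¹ * a + w j * b ≤ 3 * Real.sqrt (a * b) + δ * (a + b))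
    (x : Fin n → (H →L[ℂ] H)) (hC : 7 * minNormConj x < C) :
    ∃ y : Fin n → ι → (H →L[ℂ] H), (∀ i, ∑ j, y i j = x i) ∧
      ∀ h, weightedSq w y h ≤ C * ‖h‖ ^ 2 := by
  have hC0 : 0 ≤ C := by linarith [minNormConj_nonneg x]
  have hspan (s : Finset H) : FiniteDimensional ℂ (Submodule.span ℂ (s : Set H)) :=
    FiniteDimensional.span_finset ℂ s
  choose T hTx hT using fun s : Finset H => exists_decomposition_on_submodule hw hδ hδn hwδ x hC
    (Submodule.span ℂ (s : Set H))
  let 𝒰 : Ultrafilter (Finset H) := Ultrafilter.of atTop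
  -- A single term w_j ‖T h‖² of the weighted square is at most C ‖h‖².
  have hbound (i j s) : ‖T s i j‖ ≤ Real.sqrt (C / w j) := by
    refine ContinuousLinearMap.opNorm_le_bound _ (Real.sqrt_nonneg _) fun h => ?_
    rw [← Real.sqrt_sq (norm_nonneg h), ← Real.sqrt_mul (div_nonneg hC0 (hw j).le)]
    refine Real.le_sqrt_of_sq_le ?_
    rw [div_mul_eq_mul_div, le_div_iff₀ (hw j), mul_comm]
    refine le_trans ?_ (hT s h)
    have hterm (i j) : 0 ≤ (w j)⁻¹ * ‖star (T s i j) h‖ ^ 2 + w j * ‖T s i j h‖ ^ 2 := by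
      have := (hw j).le
      positivity
    have h1 : w j * ‖T s i j h‖ ^ 2 ≤ (w j)⁻¹ * ‖star (T s i j) h‖ ^ 2 + w j * ‖T s i j h‖ ^ 2 := by
      have := (hw j).le
      exact le_add_of_nonneg_left (by positivity)
    refine h1.trans ((Finset.single_le_sum (fun j _ => hterm i j) (Finset.mem_univ j)).trans ?_)
    exact Finset.single_le_sum
      (f := fun i => ∑ j, ((w j)⁻¹ * ‖star (T s i j) h‖ ^ 2 + w j * ‖T s i j h‖ ^ 2))
      (fun i _ => Finset.sum_nonneg fun j _ => hterm i j) (Finset.mem_univ i)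
  choose S hS using fun i j => exists_tendsto_inner_of_norm_le 𝒰 (fun s => T s i j) (hbound i j)
  refine ⟨S, fun i => ?_, fun h => weightedSq_le_of_tendsto_inner hw hS fun s => hT s h⟩
  refine ContinuousLinearMap.ext fun h => ext_inner_left ℂ fun k => ?_
  have h1 : Tendsto (fun s => inner ℂ k ((∑ j, T s i j) h)) 𝒰
      (𝓝 (inner ℂ k ((∑ j, S i j) h))) := by
    simp only [sum_apply, inner_sum]
    exact tendsto_finsetSum _ fun j _ => hS i j h k
  refine tendsto_nhds_unique h1 (tendsto_const_nhds.congr' ?_)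
  classical
  -- Once s contains h and k, the coefficient of the sum over j equals that of x_i exactly.
  have hev : ∀ᶠ s : Finset H in 𝒰, {h, k} ≤ s :=
    Ultrafilter.of_le atTop (eventually_ge_atTop ({h, k} : Finset H))
  filter_upwards [hev] with s hs
  refine (hTx s i h (Submodule.subset_span (hs ?_)) k (Submodule.subset_span (hs ?_))).symm <;> simp

/-- The form bound makes C·1 − `weightedOp w y` positive, hence of the form s*s, and f is
nonnegative there. -/
theorem IsState.re_weightedOp_le {f : (H →L[ℂ] H) →ₗ[ℂ] ℂ} (hf : IsState f) {α : Type*}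
    [Fintype α] {w : ι → ℝ} {y : α → ι → (H →L[ℂ] H)} {C : ℝ}
    (hy : ∀ h, weightedSq w y h ≤ C * ‖h‖ ^ 2) :
    ∑ i, ∑ j, ((w j)⁻¹ * (f (y i j * star (y i j))).re + w j * (f (star (y i j) * y i j)).re) ≤
      C := by
  have hpos : 0 ≤ (C : ℂ) • (1 : H →L[ℂ] H) - weightedOp w y := by
    rw [ContinuousLinearMap.nonneg_iff_isPositive, ContinuousLinearMap.isPositive_iff_complex]
    intro h
    have h1 : inner ℂ (((C : ℂ) • (1 : H →L[ℂ] H) - weightedOp w y) h) h =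
        ((C * ‖h‖ ^ 2 - weightedSq w y h : ℝ) : ℂ) := by
      rw [← inner_conj_symm]
      have h2 : inner ℂ h (((C : ℂ) • (1 : H →L[ℂ] H) - weightedOp w y) h) =
          ((C * ‖h‖ ^ 2 - weightedSq w y h : ℝ) : ℂ) := by
        simp [inner_weightedOp]
      rw [h2, Complex.conj_ofReal]
    rw [h1]
    exact ⟨rfl, sub_nonneg.mpr (hy h)⟩
  obtain ⟨s, hs⟩ := CStarAlgebra.nonneg_iff_eq_star_mul_self.mp hpos
  have h1 := hf.1 s
  rw [← hs, map_sub, map_smul, hf.2] at h1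
  have h2 := (Complex.le_def.mp h1).1
  simp only [weightedOp, map_sum, map_add, map_smul, Complex.sub_re, Complex.re_sum, smul_eq_mul,
    Complex.add_re, Complex.re_ofReal_mul, mul_one, Complex.ofReal_re, Complex.zero_re] at h2
  linarith

end WeakLimit

/-! ### Assembly and constants. -/

theorem norm_map_sum_sq_le {E F ι : Type*} [AddCommGroup E] [Module ℂ E] [NormedAddCommGroup F]
    [Module ℂ F] [Fintype ι] (u : E →ₗ[ℂ] F) (y : ι → E) :
    ‖u (∑ j, y j)‖ ^ 2 ≤ Fintype.card ι * ∑ j, ‖u (y j)‖ ^ 2 := by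
  rw [map_sum]
  refine (pow_le_pow_left₀ (norm_nonneg _) (norm_sum_le _ _) 2).trans ?_
  exact sq_sum_le_card_mul_sum_sq

theorem sqrt_mul_le_weighted {a b w : ℝ} (ha : 0 ≤ a) (hb : 0 ≤ b) (hw : 0 < w) :
    Real.sqrt (a * b) ≤ (w⁻¹ * a + w * b) / 2 := by
  have hw' : 0 < w⁻¹ := inv_pos.mpr hw
  refine Real.sqrt_le_iff.mpr ⟨by positivity, ?_⟩
  have : a * b = (w⁻¹ * a) * (w * b) := by field_simp
  rw [this]
  nlinarith [sq_nonneg (w⁻¹ * a - w * b)]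

theorem sum_norm_sq_le_card_mul {H : Type*} [NormedAddCommGroup H] [InnerProductSpace ℂ H]
    [CompleteSpace H] {F : Type*} [NormedAddCommGroup F] [Module ℂ F] {u : (H →L[ℂ] H) →ₗ[ℂ] F}
    {K : ℝ} {f : (H →L[ℂ] H) →ₗ[ℂ] ℂ} (hf : IsState f)
    (hu : ∀ x : H →L[ℂ] H,
      ‖u x‖ ^ 2 ≤ K ^ 2 * Real.sqrt ((f (x * star x)).re * (f (star x * x)).re))
    {ι : Type*} [Fintype ι] {n : ℕ} {C δ : ℝ} {w : ι → ℝ} (hw : ∀ j, 0 < w j)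
    (hδ : 0 ≤ δ) (hδn : δ * n ≤ 2)
    (hwδ : ∀ a b : ℝ, 0 ≤ a → 0 ≤ b →
      ∃ j, (w j)⁻¹ * a + w j * b ≤ 3 * Real.sqrt (a * b) + δ * (a + b))
    (x : Fin n → (H →L[ℂ] H)) (hC : 7 * minNormConj x < C) :
    ∑ i, ‖u (x i)‖ ^ 2 ≤ Fintype.card ι * K ^ 2 / 2 * C := by
  obtain ⟨y, hyx, hy⟩ := exists_decomposition_weightedSq_le hw hδ hδn hwδ x hC
  have hre (a : H →L[ℂ] H) : 0 ≤ (f (star a * a)).re := (Complex.le_def.mp (hf.1 a)).1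
  have hre' (a : H →L[ℂ] H) : 0 ≤ (f (a * star a)).re := by simpa using hre (star a)
  have h1 (i j) : ‖u (y i j)‖ ^ 2 ≤ K ^ 2 / 2 *
      ((w j)⁻¹ * (f (y i j * star (y i j))).re + w j * (f (star (y i j) * y i j)).re) := by
    refine (hu _).trans ?_
    have := mul_le_mul_of_nonneg_left (sqrt_mul_le_weighted (hre' (y i j)) (hre (y i j)) (hw j))
      (sq_nonneg K)
    linarith
  calc ∑ i, ‖u (x i)‖ ^ 2 ≤ ∑ i, (Fintype.card ι : ℝ) * ∑ j, ‖u (y i j)‖ ^ 2 :=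
        Finset.sum_le_sum fun i _ => hyx i ▸ norm_map_sum_sq_le u (y i)
    _ ≤ ∑ i, (Fintype.card ι : ℝ) * ∑ j, K ^ 2 / 2 *
          ((w j)⁻¹ * (f (y i j * star (y i j))).re + w j * (f (star (y i j) * y i j)).re) := by
        gcongr with i _ j _
        exact h1 i j
    _ = Fintype.card ι * K ^ 2 / 2 * ∑ i, ∑ j,
          ((w j)⁻¹ * (f (y i j * star (y i j))).re + w j * (f (star (y i j) * y i j)).re) := by
        simp only [← Finset.mul_sum]
        ring
    _ ≤ _ := by
        gcongr
        exact hf.re_weightedOp_le hy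

theorem two_mul_clog_add_one_le {n : ℕ} (hn : 1 < n) :
    2 * (Nat.clog 2 n : ℝ) + 1 ≤ 8 * Real.log n := by
  have hlog2 := Real.log_two_gt_d9
  have hn2 : Real.log 2 ≤ Real.log n := Real.log_le_log two_pos (by exact_mod_cast hn)
  have hpos : 0 < Nat.clog 2 n := Nat.clog_pos one_lt_two hn
  have h1 : ((Nat.clog 2 n).pred : ℝ) * Real.log 2 ≤ Real.log n := by
    rw [← Real.log_pow]
    refine Real.log_le_log (by positivity) ?_
    exact_mod_cast (Nat.pow_pred_clog_lt_self one_lt_two hn).le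
  rw [Nat.pred_eq_sub_one, Nat.cast_sub hpos, Nat.cast_one] at h1
  have h2 : (1 : ℝ) ≤ Nat.clog 2 n := by exact_mod_cast hpos
  -- With L = clog n, 2L + 1 = 2(L − 1) + 3 ≤ (5 / log 2) log n, and 5 / log 2 < 8.
  nlinarith

theorem corollary3p5 :
    ∃ c : ℝ, 0 < c ∧
      ∀ (H : Type*) [NormedAddCommGroup H] [InnerProductSpace ℂ H] [CompleteSpace H]
        (I : Type*) (u : (H →L[ℂ] H) →ₗ[ℂ] OH I) (_ : IsCompletelyBounded u)
        (K : ℝ) (f : (H →L[ℂ] H) →ₗ[ℂ] ℂ) (_ : IsState f)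
        (_ : ∀ x : H →L[ℂ] H,
          ‖u x‖ ^ 2 ≤ K ^ 2 * Real.sqrt ((f (x * star x)).re * (f (star x * x)).re))
        (n : ℕ) (_ : 1 < n) (x : Fin n → (H →L[ℂ] H)),
        ∑ i, ‖u (x i)‖ ^ 2 ≤ K ^ 2 * (c * Real.log n + 1) * minNormConj x := by
  -- 28 = 8 · 7/2: 8 from 2J + 1 ≤ 8 log n, 7 from the splitting, 1/2 from AM-GM.
  refine ⟨28, by norm_num, fun H _ _ _ I u _ K f hf hu n hn x => ?_⟩
  have hpow : (n : ℝ) ≤ 2 ^ Nat.clog 2 n := by exact_mod_cast Nat.le_pow_clog one_lt_two n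
  have hlog := two_mul_clog_add_one_le hn
  generalize Nat.clog 2 n = J at hpow hlog
  have hM := minNormConj_nonneg x
  have hcard : (Fintype.card (Finset.Icc (-(J : ℤ)) J) : ℝ) = 2 * J + 1 := by
    have : Fintype.card (Finset.Icc (-(J : ℤ)) J) = 2 * J + 1 := by
      rw [Fintype.card_coe, Int.card_Icc]
      omega
    rw [this]
    push_cast
    rfl
  have key (C : ℝ) (hC : 7 * minNormConj x < C) :
      ∑ i, ‖u (x i)‖ ^ 2 ≤ (2 * J + 1) * K ^ 2 / 2 * C := by
    rw [← hcard]
    refine sum_norm_sq_le_card_mul hf hu (δ := 2 / 2 ^ J)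
      (w := fun j : Finset.Icc (-(J : ℤ)) J => (2 : ℝ) ^ (j : ℤ)) (fun j => by positivity)
      (by positivity) ?_ (fun a b ha hb => ?_) x hC
    · rw [div_mul_eq_mul_div, div_le_iff₀ (by positivity)]
      linarith
    · obtain ⟨j, hj, hle⟩ := exists_zpow_two_mul_add_le J ha hb
      exact ⟨⟨j, hj⟩, hle⟩
  -- Letting C decrease to 7M removes the strict inequality.
  have hlim : Filter.Tendsto (fun C : ℝ => (2 * J + 1) * K ^ 2 / 2 * C)
      (nhdsWithin (7 * minNormConj x) (Set.Ioi (7 * minNormConj x)))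
      (nhds ((2 * J + 1) * K ^ 2 / 2 * (7 * minNormConj x))) :=
    ((continuous_const.mul continuous_id).tendsto _).mono_left nhdsWithin_le_nhds
  refine (ge_of_tendsto hlim (Filter.eventually_of_mem self_mem_nhdsWithin key)).trans ?_
  have hKM : 0 ≤ K ^ 2 * minNormConj x := by positivity
  nlinarith [mul_le_mul_of_nonneg_left hlog hKM]

end
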